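/- Let $S=(S^x,S^y)$ and $T=(T^x,T^y)$ be vector fields in the Sobolev space $W^{1,1}(\mathbb{R}^2,\mathbb{R}^2)$ such that $S^x\ge 0$, $T^y\ge 0$ and $\det(S,T):=S^xT^y-S^yT^x\ge 0$ almost everywhere. Then $\det(S,T)$ is integrable on $\mathbb{R}^2$ and $$\int_{\mathbb{R}^2}\det(S,T)\;\le\;\frac14\Big(\int_{\mathbb{R}^2}|\operatorname{div}S|\Big)\Big(\int_{\mathbb{R}^2}|\operatorname{div}T|\Big),$$ where $\operatorname{div}S=\partial_xS^x+\partial_yS^y$ is the weak divergence. Moreover, the constant $\frac14$ is sharp: for every real $C<\frac14$ there are $S,T\in W^{1,1}(\mathbb{R}^2,\mathbb{R}^2)$ satisfying the same assumptions with $$\int_{\mathbb{R}^2}\det(S,T)\;>\;C\Big(\int_{\mathbb{R}^2}|\operatorname{div}S|\Big)\Big(\int_{\mathbb{R}^2}|\operatorname{div}T|\Big).$$ -/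

import Mathlib

open MeasureTheory
open scoped ContDiff

namespace PlaneSobolev

/-- The plane with coordinates `(x, y) = (p.1, p.2)` and Lebesgue measure `volume`
(the product of the one-dimensional Lebesgue measures). The choice of a norm on `ℝ²` is irrelevant
below: only Lebesgue integrals, integrability and smoothness are used. -/
abbrev Plane : Type := ℝ × ℝ

/-- `g` is a weak (distributional) derivative of `f` in the direction `v`:
`∫ f ∂ᵥφ = - ∫ g φ` for all `φ ∈ C_c^∞(ℝ²)`, where `f` and `g` are locally integrable. -/
def IsWeakDeriv (v : Plane) (f g : Plane → ℝ) : Prop :=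
  LocallyIntegrable f volume ∧ LocallyIntegrable g volume ∧
    ∀ φ : Plane → ℝ, ContDiff ℝ ∞ φ → HasCompactSupport φ →
      ∫ p, f p * fderiv ℝ φ p v = -∫ p, g p * φ p

/-- The scalar Sobolev space `W^{1,1}(ℝ²)`: `f ∈ L¹(ℝ²)`, and both first order
weak partial derivatives of `f` exist and belong to `L¹(ℝ²)`. -/
def MemW11 (f : Plane → ℝ) : Prop :=
  Integrable f volume ∧
    (∃ g, Integrable g volume ∧ IsWeakDeriv (1, 0) f g) ∧
    (∃ g, Integrable g volume ∧ IsWeakDeriv (0, 1) f g)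

/-- The Sobolev space `W^{1,1}(ℝ², ℝ²)` of vector fields, componentwise. -/
def MemW11Field (S : Plane → Plane) : Prop :=
  MemW11 (fun p => (S p).1) ∧ MemW11 (fun p => (S p).2)

open Classical in
/-- A representative of the weak derivative of `f` in the direction `v` (which is unique up to
equality a.e.), and `0` by convention if `f` has no weak derivative in this direction. -/
noncomputable def weakDeriv (v : Plane) (f : Plane → ℝ) : Plane → ℝ :=
  if h : ∃ g, IsWeakDeriv v f g then h.choose else 0

/-- The weak divergence `div S = ∂ₓ Sˣ + ∂_y Sʸ` of a vector field on the plane. -/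
noncomputable def weakDiv (S : Plane → Plane) (p : Plane) : ℝ :=
  weakDeriv (1, 0) (fun q => (S q).1) p + weakDeriv (0, 1) (fun q => (S q).2) p

/-- The pointwise determinant `det(S, T) = Sˣ Tʸ - Sʸ Tˣ` of the matrix with rows `S` and `T`. -/
noncomputable def fieldDet (S T : Plane → Plane) (p : Plane) : ℝ :=
  Matrix.det !![(S p).1, (S p).2; (T p).1, (T p).2]

/-- The hypotheses on a pair of vector fields: `S, T ∈ W^{1,1}(ℝ², ℝ²)` with
`Sˣ ≥ 0`, `Tʸ ≥ 0` and `det(S, T) ≥ 0` almost everywhere. -/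
structure Admissible (S T : Plane → Plane) : Prop where
  left_mem : MemW11Field S
  right_mem : MemW11Field T
  left_nonneg : ∀ᵐ p, 0 ≤ (S p).1
  right_nonneg : ∀ᵐ p, 0 ≤ (T p).2
  det_nonneg : ∀ᵐ p, 0 ≤ fieldDet S T p

end PlaneSobolev

/-!
For vector fields `S`, `T` that are smooth with compact support, the inequality is a calibration
argument. As `T^y ≥ 0`, the function
`φ(x, y) = ∫_{-∞}^x ∫ (div T)⁺(u, t) dt du - ∫_{-∞}^y T^x(x, t) dt`
satisfies `∂_y φ = -T^x`, `∂ₓ φ ≥ T^y ≥ 0` and `0 ≤ φ ≤ ½ ∫ |div T|` (`exists_potential`). As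
`S^x ≥ 0`, it follows that `det(S, T) ≤ S · ∇φ`. After integration by parts,
`∫ det(S, T) ≤ -∫ φ div S`, and since `∫ div S = 0` the potential can be
centred at `¼ ∫ |div T|`, which gives the constant `¼`
(`integral_det_le_of_contDiff`). The determinant may change sign here, so that the regularized
fields only have to keep the signs of `S^x` and `T^y`.

For `S`, `T` in `W^{1,1}`, mollify and cut off. Neither operation destroys the signs; the `L¹` norms
of the divergences increase at most by a quantity tending to zero
(`integral_abs_fderiv_add_fderiv_cutoff_mul_mollify_le`), and the `L²` norms, finite by the Sobolev
inequality (`MemW11.integrable_sq`), do not increase. Fatou's lemma, applied to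
`½ (|S|² + |T|²) + det(S, T) ≥ 0`, then yields the inequality in the limit (`integral_det_le`).

The constant is attained by `S = (f(x) g(y), 0)` and `T = (0, g(x) f(y))`, where `g ≥ 0` is
supported on the plateau `{f = 1}` of a function `f` that climbs from `0` to `1` and descends again: then
`∫ |div S| = ∫ |div T| = 2 ∫ g` and `∫ det(S, T) = (∫ g)²`.
-/

namespace PlaneSobolev

open Set Filter Topology
open scoped Convolution

/-! ### A potential for a smooth compactly supported field -/

theorem hasDerivAt_slice_fst {f : Plane → ℝ} (hf : ContDiff ℝ 1 f) (x y : ℝ) :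
    HasDerivAt (fun u => f (u, y)) (fderiv ℝ f (x, y) (1, 0)) x :=
  ((hf.differentiable one_ne_zero (x, y)).hasFDerivAt.comp_hasDerivAt x
    ((hasDerivAt_id x).prodMk (hasDerivAt_const x y)))

theorem hasDerivAt_slice_snd {f : Plane → ℝ} (hf : ContDiff ℝ 1 f) (x y : ℝ) :
    HasDerivAt (fun v => f (x, v)) (fderiv ℝ f (x, y) (0, 1)) y :=
  ((hf.differentiable one_ne_zero (x, y)).hasFDerivAt.comp_hasDerivAt y
    ((hasDerivAt_const y x).prodMk (hasDerivAt_id y)))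

/-- A partial derivative, in the form used by the integration by parts for line derivatives, which
needs no joint differentiability. -/
theorem hasLineDerivAt_of_slice_fst {f : Plane → ℝ} {f' x y : ℝ}
    (h : HasDerivAt (fun u => f (u, y)) f' x) : HasLineDerivAt ℝ f f' (x, y) (1, 0) := by
  have : HasDerivAt (fun u => f (u, y)) f' (x + 0) := by simpa using h
  simpa [HasLineDerivAt] using this.comp_const_add x 0

theorem hasLineDerivAt_of_slice_snd {f : Plane → ℝ} {f' x y : ℝ}
    (h : HasDerivAt (fun v => f (x, v)) f' y) : HasLineDerivAt ℝ f f' (x, y) (0, 1) := by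
  have : HasDerivAt (fun v => f (x, v)) f' (y + 0) := by simpa using h
  simpa [HasLineDerivAt] using this.comp_const_add y 0

theorem continuous_fderiv_apply {f : Plane → ℝ} (hf : ContDiff ℝ 1 f) (v : Plane) :
    Continuous fun p => fderiv ℝ f p v :=
  (hf.continuous_fderiv one_ne_zero).clm_apply continuous_const

theorem integrable_fderiv_apply {f : Plane → ℝ} (hf : ContDiff ℝ 1 f) (hc : HasCompactSupport f)
    (v : Plane) : Integrable fun p => fderiv ℝ f p v :=
  (continuous_fderiv_apply hf v).integrable_of_hasCompactSupport (hc.fderiv_apply ℝ v)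

theorem integral_fderiv_apply_eq_zero {f : Plane → ℝ} (hf : ContDiff ℝ 1 f)
    (hc : HasCompactSupport f) (v : Plane) : ∫ p, fderiv ℝ f p v = 0 := by
  have := integral_mul_fderiv_eq_neg_fderiv_mul_of_integrable (μ := volume)
    (f := fun _ : Plane => (1 : ℝ)) (g := f) (v := v) (by simp)
    (by simpa using integrable_fderiv_apply hf hc v)
    (by simpa using hf.continuous.integrable_of_hasCompactSupport hc)
    (fun x _ => by fun_prop) (fun x _ => hf.differentiable one_ne_zero x)
  simpa using this

/-- Integration by parts where `f` is only assumed to have a continuous derivative in the direction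
`v`. It is applied to the potential of `exists_potential`, whose two partial derivatives are known
separately. -/
theorem integral_hasLineDerivAt_mul_eq_neg {f f' g : Plane → ℝ} {v : Plane} (hf : Continuous f)
    (hf' : Continuous f') (hd : ∀ p, HasLineDerivAt ℝ f (f' p) p v) (hg : ContDiff ℝ 1 g)
    (hc : HasCompactSupport g) : ∫ p, g p * f' p = -∫ p, f p * fderiv ℝ g p v := by
  have h1 := hg.continuous
  have h2 := continuous_fderiv_apply hg v
  have := integral_bilinear_hasLineDerivAt_right_eq_neg_left_of_integrable (μ := volume)
    (f := f) (f' := f') (g := g) (g' := fun p => fderiv ℝ g p v) (v := v)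
    (B := ContinuousLinearMap.mul ℝ ℝ)
    ((hf'.mul h1).integrable_of_hasCompactSupport hc.mul_left)
    ((hf.mul h2).integrable_of_hasCompactSupport (hc.fderiv_apply ℝ v).mul_left)
    ((hf.mul h1).integrable_of_hasCompactSupport hc.mul_left)
    (fun p _ => hd p)
    (fun p _ => (hg.differentiable one_ne_zero p).hasFDerivAt.hasLineDerivAt v)
  simp only [ContinuousLinearMap.mul_apply'] at this
  rw [this, neg_neg]
  exact integral_congr_ae (.of_forall fun p => mul_comm _ _)

theorem hasDerivAt_intervalIntegral_slice {a : Plane → ℝ} (ha : ContDiff ℝ 1 a)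
    (r x y : ℝ) : HasDerivAt (fun u => ∫ t in r..y, a (u, t))
      (∫ t in r..y, fderiv ℝ a (x, t) (1, 0)) x := by
  have hD := continuous_fderiv_apply ha (1, 0)
  have hac := ha.continuous
  obtain ⟨K, hK⟩ := ((isCompact_closedBall x 1).prod (isCompact_uIcc (a := r)
    (b := y))).exists_bound_of_continuousOn hD.continuousOn
  refine (intervalIntegral.hasDerivAt_integral_of_dominated_loc_of_deriv_le
    (F := fun u t => a (u, t)) (F' := fun u t => fderiv ℝ a (u, t) (1, 0)) (bound := fun _ => K)
    (Metric.ball_mem_nhds x one_pos) ?_ ?_ ?_ ?_ ?_ ?_).2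
  · exact .of_forall fun u => (by fun_prop : Continuous fun t => a (u, t)).aestronglyMeasurable
  · exact (by fun_prop : Continuous fun t => a (x, t)).intervalIntegrable _ _
  · exact (hD.comp (by fun_prop : Continuous fun t : ℝ => (x, t))).aestronglyMeasurable
  · exact .of_forall fun t ht u hu =>
      hK (u, t) ⟨Metric.ball_subset_closedBall hu, uIoc_subset_uIcc ht⟩
  · exact intervalIntegrable_const
  · exact .of_forall fun t _ u _ => hasDerivAt_slice_fst ha u t

theorem eq_zero_of_tsupport_subset_ball {f : Plane → ℝ} {R : ℝ}
    (h : tsupport f ⊆ Metric.ball 0 R) {x y : ℝ} (hxy : R ≤ |x| ∨ R ≤ |y|) : f (x, y) = 0 := by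
  refine image_eq_zero_of_notMem_tsupport fun hp => ?_
  have := h hp
  simp only [mem_ball_zero_iff, Prod.norm_def, Real.norm_eq_abs, max_lt_iff] at this
  rcases hxy with h | h
  · exact absurd this.1 (not_lt.2 h)
  · exact absurd this.2 (not_lt.2 h)

/-- The calibrating potential of `T = (a, b)` with `b ≥ 0`: it satisfies `∂_y φ = -a` and
`∂ₓ φ ≥ b`, and takes values between `0` and `½ ∫ |div T|`. It is
`φ(x, y) = ∫_{-∞}^x ∫ (div T)⁺(u, t) dt du - ∫_{-∞}^y a(x, t) dt`; with
`∂ₓ a = div T - ∂_y b` this gives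
`∂ₓ φ(x, y) = b(x, y) + ∫ (div T)⁺(x, t) dt - ∫_{-∞}^y div T(x, t) dt`. In particular `φ`
increases in `x`, so its bounds are its limits as `x → ∓∞`. -/
theorem exists_potential {a b : Plane → ℝ} (ha : ContDiff ℝ 1 a) (hb : ContDiff ℝ 1 b)
    (hac : HasCompactSupport a) (hbc : HasCompactSupport b) (hb0 : ∀ p, 0 ≤ b p) :
    ∃ φ φx : Plane → ℝ, Continuous φ ∧ Continuous φx ∧
      (∀ p, HasLineDerivAt ℝ φ (φx p) p (1, 0)) ∧ (∀ p, HasLineDerivAt ℝ φ (-a p) p (0, 1)) ∧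
      (∀ p, b p ≤ φx p) ∧ ∀ p, 0 ≤ φ p ∧
        φ p ≤ 1 / 2 * ∫ q, |fderiv ℝ a q (1, 0) + fderiv ℝ b q (0, 1)| := by
  obtain ⟨R, hRa, hRb⟩ : ∃ R, tsupport a ⊆ Metric.ball 0 R ∧ tsupport b ⊆ Metric.ball 0 R := by
    obtain ⟨R, hR⟩ := (hac.isCompact.union hbc.isCompact).isBounded.subset_ball 0
    exact ⟨R, subset_union_left.trans hR, subset_union_right.trans hR⟩
  set d : Plane → ℝ := fun q => fderiv ℝ a q (1, 0) + fderiv ℝ b q (0, 1) with hd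
  have hdc : Continuous d := (continuous_fderiv_apply ha _).add (continuous_fderiv_apply hb _)
  have hd0 : ∀ {x y : ℝ}, R ≤ |x| ∨ R ≤ |y| → d (x, y) = 0 := fun {x y} h => by
    have h1 := eq_zero_of_tsupport_subset_ball ((tsupport_fderiv_apply_subset ℝ _).trans hRa) h
      (f := fun q => fderiv ℝ a q (1, 0))
    have h2 := eq_zero_of_tsupport_subset_ball ((tsupport_fderiv_apply_subset ℝ _).trans hRb) h
      (f := fun q => fderiv ℝ b q (0, 1))
    simp only [hd, h1, h2, add_zero]
  have hdi : Integrable d :=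
    (integrable_fderiv_apply ha hac _).add (integrable_fderiv_apply hb hbc _)
  have hacont := ha.continuous
  set P : ℝ → ℝ := fun x => ∫ t in (-R)..R, max (d (x, t)) 0 with hP
  have hPc : Continuous P :=
    intervalIntegral.continuous_parametric_intervalIntegral_of_continuous'
      (f := fun x t => max (d (x, t)) 0) (by fun_prop) _ _
  have hsupp : ∀ x, Function.support (fun t => max (d (x, t)) 0) ⊆ Ioc (-R) R := fun x t ht => by
    by_contra hn
    refine ht ?_
    have : R ≤ |t| := by
      by_contra! h
      exact hn ⟨(abs_lt.1 h).1, (abs_lt.1 h).2.le⟩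
    simp [hd0 (Or.inr this)]
  have hPint : ∀ x, P x = ∫ t, max (d (x, t)) 0 := fun x =>
    intervalIntegral.integral_eq_integral_of_support_subset (hsupp x)
  have hP0 : ∀ x, 0 ≤ P x := fun x => by
    rw [hPint]; exact integral_nonneg fun t => le_max_right _ _
  have hPz : ∀ {x}, R ≤ |x| → P x = 0 := fun {x} hx => by
    rw [hPint]; simp [hd0 (Or.inl hx)]
  -- the positive and the negative part of a function of vanishing integral have equal integrals
  have hPM : ∫ x, P x = 1 / 2 * ∫ q, |d q| := by
    have h0 : ∫ q, d q = 0 := by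
      rw [hd, integral_add (integrable_fderiv_apply ha hac _) (integrable_fderiv_apply hb hbc _),
        integral_fderiv_apply_eq_zero ha hac, integral_fderiv_apply_eq_zero hb hbc, add_zero]
    have h1 : ∀ q, max (d q) 0 = 1 / 2 * (|d q| + d q) := fun q => by
      rcases le_total (d q) 0 with h | h
      · rw [max_eq_right h, abs_of_nonpos h]; ring
      · rw [max_eq_left h, abs_of_nonneg h]; ring
    simp_rw [hPint]
    rw [← integral_prod (fun q : ℝ × ℝ => max (d q) 0) hdi.pos_part]
    change ∫ q : Plane, max (d q) 0 = _
    simp_rw [h1]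
    rw [integral_const_mul, integral_add hdi.abs hdi, h0, add_zero]
  -- for `y < -R` the oriented interval integral vanishes, `d` being supported in `|t| < R`
  have hlow : ∀ x y, ∫ t in (-R)..y, d (x, t) ≤ P x := fun x y => by
    rcases le_total (-R) y with h | h
    · calc ∫ t in (-R)..y, d (x, t) ≤ ∫ t in (-R)..y, max (d (x, t)) 0 :=
            intervalIntegral.integral_mono_on h
              ((by fun_prop : Continuous fun t => d (x, t)).intervalIntegrable _ _)
              ((by fun_prop : Continuous fun t => max (d (x, t)) 0).intervalIntegrable _ _)
              fun t _ => le_max_left _ _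
        _ ≤ ∫ t, max (d (x, t)) 0 := by
            rw [intervalIntegral.integral_of_le h]
            refine setIntegral_le_integral ?_ (.of_forall fun t => le_max_right _ _)
            exact (by fun_prop : Continuous fun t => max (d (x, t)) 0).integrable_of_hasCompactSupport
              (HasCompactSupport.intro' isCompact_Icc isClosed_Icc
                fun t ht => Function.notMem_support.1 fun h => ht (Ioc_subset_Icc_self (hsupp x h)))
        _ = P x := (hPint x).symm
    · rw [intervalIntegral.integral_symm, intervalIntegral.integral_zero_ae, neg_zero]
      · exact hP0 x
      · refine .of_forall fun t ht => hd0 (Or.inr ?_)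
        rw [uIoc_of_le h] at ht
        exact (le_neg.1 ht.2).trans (neg_le_abs t)
  set φ : Plane → ℝ := fun p => (∫ u in (-R)..p.1, P u) - ∫ t in (-R)..p.2, a (p.1, t) with hφ
  set φx : Plane → ℝ := fun p => P p.1 - (∫ t in (-R)..p.2, d (p.1, t)) + b p with hφx
  have hderx : ∀ x y, HasDerivAt (fun u => φ (u, y)) (φx (x, y)) x := fun x y => by
    have h1 : HasDerivAt (fun u => ∫ u in (-R)..u, P u) (P x) x :=
      (hPc.integral_hasStrictDerivAt _ _).hasDerivAt
    refine (h1.sub (hasDerivAt_intervalIntegral_slice ha (-R) x y)).congr_deriv ?_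
    have h2 : ∫ t in (-R)..y, fderiv ℝ b (x, t) (0, 1) = b (x, y) - b (x, -R) :=
      intervalIntegral.integral_eq_sub_of_hasDerivAt (fun t _ => hasDerivAt_slice_snd hb x t)
        (((continuous_fderiv_apply hb _).comp
          (by fun_prop : Continuous fun t : ℝ => (x, t))).intervalIntegrable _ _)
    have h3 : ∫ t in (-R)..y, d (x, t) = (∫ t in (-R)..y, fderiv ℝ a (x, t) (1, 0)) +
        ∫ t in (-R)..y, fderiv ℝ b (x, t) (0, 1) :=
      intervalIntegral.integral_add
        (((continuous_fderiv_apply ha _).comp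
          (by fun_prop : Continuous fun t : ℝ => (x, t))).intervalIntegrable _ _)
        (((continuous_fderiv_apply hb _).comp
          (by fun_prop : Continuous fun t : ℝ => (x, t))).intervalIntegrable _ _)
    have h4 : b (x, -R) = 0 :=
      eq_zero_of_tsupport_subset_ball hRb (Or.inr (by rw [abs_neg]; exact le_abs_self R))
    simp only [hφx, h3, h2, h4]
    ring
  have hbx : ∀ p, b p ≤ φx p := fun p => by
    have := hlow p.1 p.2
    simp only [hφx]; linarith
  have hmono : ∀ y, Monotone fun x => φ (x, y) := fun y =>
    monotone_of_hasDerivAt_nonneg (fun x => hderx x y) fun x => (hb0 _).trans (hbx _)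
  have hzero : ∀ {x y : ℝ}, R ≤ |x| → ∫ t in (-R)..y, a (x, t) = 0 := fun {x y} hx => by
    simp [eq_zero_of_tsupport_subset_ball hRa (Or.inl hx)]
  refine ⟨φ, φx, ?_, ?_, fun p => hasLineDerivAt_of_slice_fst (hderx p.1 p.2), fun p => ?_, hbx,
    fun p => ⟨?_, ?_⟩⟩
  · refine ((intervalIntegral.continuous_primitive (fun _ _ => hPc.intervalIntegrable _ _) _).comp
      continuous_fst).sub ?_
    exact intervalIntegral.continuous_parametric_intervalIntegral_of_continuous
      (f := fun (p : Plane) t => a (p.1, t)) (by fun_prop) continuous_snd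
  · have hbcont := hb.continuous
    refine ((hPc.comp continuous_fst).sub ?_).add hbcont
    exact intervalIntegral.continuous_parametric_intervalIntegral_of_continuous
      (f := fun (p : Plane) t => d (p.1, t)) (by fun_prop) continuous_snd
  · refine hasLineDerivAt_of_slice_snd (x := p.1) (y := p.2) ?_
    have h1 : HasDerivAt (fun v => ∫ t in (-R)..v, a (p.1, t)) (a p) p.2 :=
      ((by fun_prop : Continuous fun t => a (p.1, t)).integral_hasStrictDerivAt _ _).hasDerivAt
    simpa [hφ] using h1.const_sub (∫ u in (-R)..p.1, P u)
  · have hx : R ≤ |min p.1 (-R)| := (le_neg.1 (min_le_right p.1 (-R))).trans (neg_le_abs _)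
    refine le_trans (le_of_eq ?_) (hmono p.2 (min_le_left p.1 (-R)))
    simp only [hφ, hzero hx, sub_zero]
    rw [intervalIntegral.integral_symm, intervalIntegral.integral_zero_ae, neg_zero]
    refine .of_forall fun u hu => hPz ?_
    rw [uIoc_of_le (min_le_right _ _)] at hu
    exact (le_neg.1 hu.2).trans (neg_le_abs u)
  · have hx : R ≤ |max p.1 R| := (le_max_right _ _).trans (le_abs_self _)
    refine (hmono p.2 (le_max_left p.1 R)).trans ?_
    simp only [hφ, hzero hx, sub_zero]
    rw [← hPM, intervalIntegral.integral_eq_integral_of_support_subset]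
    intro u hu
    have hu' : |u| < R := not_le.1 fun h => hu (hPz h)
    exact ⟨(abs_lt.1 hu').1, (abs_lt.1 hu').2.le.trans (le_max_right _ _)⟩

/-! ### The inequality for smooth fields -/

/-- The inequality for `S = (s, t)` and `T = (a, b)` of class `C¹` with compact support: pair `S`
with the gradient of the potential of `T` and integrate by parts. The determinant may change
sign. -/
theorem integral_det_le_of_contDiff {s t a b : Plane → ℝ}
    (hs : ContDiff ℝ 1 s) (ht : ContDiff ℝ 1 t) (ha : ContDiff ℝ 1 a) (hb : ContDiff ℝ 1 b)
    (hsc : HasCompactSupport s) (htc : HasCompactSupport t) (hac : HasCompactSupport a)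
    (hbc : HasCompactSupport b) (hs0 : ∀ p, 0 ≤ s p) (hb0 : ∀ p, 0 ≤ b p) :
    ∫ p, (s p * b p - t p * a p) ≤
      1 / 4 * (∫ p, |fderiv ℝ s p (1, 0) + fderiv ℝ t p (0, 1)|) *
        ∫ p, |fderiv ℝ a p (1, 0) + fderiv ℝ b p (0, 1)| := by
  obtain ⟨φ, φx, hφ, hφx, hdx, hdy, hle, hbd⟩ := exists_potential ha hb hac hbc hb0
  set M : ℝ := ∫ q, |fderiv ℝ a q (1, 0) + fderiv ℝ b q (0, 1)|
  have hsx := integrable_fderiv_apply hs hsc (1, 0)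
  have hty := integrable_fderiv_apply ht htc (0, 1)
  have hsφx : Integrable fun p => s p * φx p :=
    (hs.continuous.mul hφx).integrable_of_hasCompactSupport hsc.mul_right
  have hta : Integrable fun p => t p * -a p :=
    (ht.continuous.mul ha.continuous.neg).integrable_of_hasCompactSupport htc.mul_right
  have hsb : Integrable fun p => s p * b p :=
    (hs.continuous.mul hb.continuous).integrable_of_hasCompactSupport hsc.mul_right
  have hφs : Integrable fun p => φ p * fderiv ℝ s p (1, 0) :=
    (hφ.mul (continuous_fderiv_apply hs _)).integrable_of_hasCompactSupport
      (hsc.fderiv_apply ℝ _).mul_left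
  have hφt : Integrable fun p => φ p * fderiv ℝ t p (0, 1) :=
    (hφ.mul (continuous_fderiv_apply ht _)).integrable_of_hasCompactSupport
      (htc.fderiv_apply ℝ _).mul_left
  have hφe : Integrable fun p => φ p * (fderiv ℝ s p (1, 0) + fderiv ℝ t p (0, 1)) :=
    (hφs.add hφt).congr (.of_forall fun p => (mul_add _ _ _).symm)
  have he : Integrable fun p => fderiv ℝ s p (1, 0) + fderiv ℝ t p (0, 1) := hsx.add hty
  have he0 : ∫ p, (fderiv ℝ s p (1, 0) + fderiv ℝ t p (0, 1)) = 0 := by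
    rw [integral_add hsx hty, integral_fderiv_apply_eq_zero hs hsc,
      integral_fderiv_apply_eq_zero ht htc, add_zero]
  calc ∫ p, (s p * b p - t p * a p) ≤ ∫ p, (s p * φx p + t p * -a p) := by
        refine integral_mono ((hsb.add hta).congr (.of_forall fun p => by simp; ring))
          (hsφx.add hta) fun p => ?_
        have := mul_le_mul_of_nonneg_left (hle p) (hs0 p)
        simp only [mul_neg]; linarith
    _ = -∫ p, φ p * (fderiv ℝ s p (1, 0) + fderiv ℝ t p (0, 1)) := by
        rw [integral_add hsφx hta, integral_hasLineDerivAt_mul_eq_neg hφ hφx hdx hs hsc,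
          integral_hasLineDerivAt_mul_eq_neg (f' := fun p => -a p) hφ ha.continuous.neg hdy ht htc]
        simp only [mul_add]
        rw [integral_add hφs hφt]
        ring
    -- as `div S` has vanishing integral, `φ` may be centred at the middle of its range
    _ = ∫ p, (1 / 4 * M - φ p) * (fderiv ℝ s p (1, 0) + fderiv ℝ t p (0, 1)) := by
        simp only [sub_mul]
        rw [integral_sub (he.const_mul _) hφe, integral_const_mul, he0]
        ring
    _ ≤ ∫ p, 1 / 4 * M * |fderiv ℝ s p (1, 0) + fderiv ℝ t p (0, 1)| := by
        refine integral_mono ?_ (he.abs.const_mul _) fun p => ?_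
        · exact ((he.const_mul _).sub hφe).congr (.of_forall fun p => (sub_mul _ _ _).symm)
        · refine (le_abs_self _).trans ?_
          rw [abs_mul]
          refine mul_le_mul_of_nonneg_right (abs_le.2 ?_) (abs_nonneg _)
          have := hbd p
          constructor <;> linarith
    _ = _ := by rw [integral_const_mul]; ring

/-! ### Mollification -/

/-- The convolution of `f` with the bump function `η`, normalized to have integral one. -/
noncomputable def mollify (η : ContDiffBump (0 : Plane)) (f : Plane → ℝ) : Plane → ℝ :=
  η.normed volume ⋆[ContinuousLinearMap.lsmul ℝ ℝ, volume] f

theorem mollify_apply (η : ContDiffBump (0 : Plane)) (f : Plane → ℝ) (p : Plane) :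
    mollify η f p = ∫ q, η.normed volume (p - q) * f q := by
  simp [mollify, convolution_eq_swap]

theorem integrable_normed_mul (η : ContDiffBump (0 : Plane)) {f : Plane → ℝ} (hf : Integrable f)
    (p : Plane) : Integrable fun q => η.normed volume (p - q) * f q := by
  obtain ⟨K, hK⟩ := η.hasCompactSupport_normed.exists_bound_of_continuous
    (η.continuous_normed (μ := volume))
  exact hf.bdd_mul (c := K)
    (η.continuous_normed.comp (by fun_prop : Continuous fun q => p - q)).aestronglyMeasurable
    (.of_forall fun q => hK _)

theorem contDiff_mollify (η : ContDiffBump (0 : Plane)) {f : Plane → ℝ} (hf : Integrable f) :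
    ContDiff ℝ 1 (mollify η f) :=
  η.hasCompactSupport_normed.contDiff_convolution_left (n := 1) _ η.contDiff_normed
    hf.locallyIntegrable

theorem mollify_nonneg (η : ContDiffBump (0 : Plane)) {f : Plane → ℝ} (hf : ∀ᵐ p, 0 ≤ f p)
    (p : Plane) : 0 ≤ mollify η f p := by
  rw [mollify_apply]
  refine integral_nonneg_of_ae ?_
  filter_upwards [hf] with q hq
  exact mul_nonneg (η.nonneg_normed _) hq

theorem mollify_add (η : ContDiffBump (0 : Plane)) {f g : Plane → ℝ} (hf : Integrable f)
    (hg : Integrable g) (p : Plane) :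
    mollify η (fun q => f q + g q) p = mollify η f p + mollify η g p := by
  simp only [mollify_apply, mul_add]
  exact integral_add (integrable_normed_mul η hf p) (integrable_normed_mul η hg p)

theorem integrable_mollify (η : ContDiffBump (0 : Plane)) {f : Plane → ℝ} (hf : Integrable f) :
    Integrable (mollify η f) :=
  η.integrable_normed.integrable_convolution _ hf

theorem integral_mollify (η : ContDiffBump (0 : Plane)) {f : Plane → ℝ} (hf : Integrable f) :
    ∫ p, mollify η f p = ∫ p, f p := by
  have := integral_convolution (ContinuousLinearMap.lsmul ℝ ℝ)
    (η.integrable_normed (μ := volume)) hf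
  rw [η.integral_normed] at this
  exact this.trans (one_smul ℝ _)

theorem integral_abs_mollify_le (η : ContDiffBump (0 : Plane)) {f : Plane → ℝ}
    (hf : Integrable f) : ∫ p, |mollify η f p| ≤ ∫ p, |f p| := by
  rw [← integral_mollify η hf.abs]
  refine integral_mono (integrable_mollify η hf).abs (integrable_mollify η hf.abs) fun p => ?_
  simp only [mollify_apply]
  refine abs_integral_le_integral_abs.trans (le_of_eq ?_)
  simp only [abs_mul, abs_of_nonneg (η.nonneg_normed _)]

/-- Jensen's inequality for the square and the probability density `q ↦ η (p - q)`. -/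
theorem sq_mollify_le (η : ContDiffBump (0 : Plane)) {f : Plane → ℝ} (hf : Integrable f)
    (hf2 : Integrable fun p => f p ^ 2) (p : Plane) :
    mollify η f p ^ 2 ≤ mollify η (fun q => f q ^ 2) p := by
  set m := mollify η f p with hm
  have h1 := integrable_normed_mul η hf p
  have h2 := integrable_normed_mul η hf2 p
  have h3 : Integrable fun q => η.normed volume (p - q) := η.integrable_normed.comp_sub_left p
  have h4 : ∫ q, η.normed volume (p - q) = 1 := by
    rw [integral_sub_left_eq_self (η.normed volume) volume p, η.integral_normed]
  have h5 : 0 ≤ ∫ q, η.normed volume (p - q) * (f q - m) ^ 2 :=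
    integral_nonneg fun q => mul_nonneg (η.nonneg_normed _) (sq_nonneg _)
  have h6 : ∫ q, η.normed volume (p - q) * (f q - m) ^ 2 =
      mollify η (fun q => f q ^ 2) p - 2 * m * m + m ^ 2 * 1 := by
    have h7 : ∀ q, η.normed volume (p - q) * (f q - m) ^ 2 =
        η.normed volume (p - q) * f q ^ 2 + -(2 * m) * (η.normed volume (p - q) * f q) +
          m ^ 2 * η.normed volume (p - q) := fun q => by ring
    have h8 : ∫ q, η.normed volume (p - q) * f q = m := (mollify_apply η f p).symm
    have h9 : Integrable fun q => η.normed volume (p - q) * f q ^ 2 +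
        -(2 * m) * (η.normed volume (p - q) * f q) := h2.add (h1.const_mul _)
    simp only [h7]
    rw [integral_add h9 (h3.const_mul _), integral_add h2 (h1.const_mul _),
      integral_const_mul, integral_const_mul, h4, h8, mollify_apply]
    ring
  nlinarith

/-- Mollification turns weak derivatives into classical ones. -/
theorem fderiv_mollify (η : ContDiffBump (0 : Plane)) {f g : Plane → ℝ} {v : Plane}
    (hf : Integrable f) (h : IsWeakDeriv v f g) (p : Plane) :
    fderiv ℝ (mollify η f) p v = mollify η g p := by
  have hη : ContDiff ℝ 1 (η.normed (volume : Measure Plane)) := η.contDiff_normed (n := 1)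
  have hd := η.hasCompactSupport_normed.hasFDerivAt_convolution_left
    (ContinuousLinearMap.lsmul ℝ ℝ) hη hf.locallyIntegrable p
  have hex : ConvolutionExistsAt (fderiv ℝ (η.normed volume)) f p
      ((ContinuousLinearMap.lsmul ℝ ℝ).precompL Plane) volume :=
    (η.hasCompactSupport_normed.fderiv ℝ).convolutionExists_left _
      (hη.continuous_fderiv one_ne_zero) hf.locallyIntegrable p
  have hφ : ∀ q, HasFDerivAt (fun q => η.normed volume (p - q))
      (-fderiv ℝ (η.normed volume) (p - q)) q := fun q => by
    have h1 := (hη.differentiable one_ne_zero (p - q)).hasFDerivAt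
    have h2 : HasFDerivAt (fun q : Plane => p - q) (-ContinuousLinearMap.id ℝ Plane) q :=
      (hasFDerivAt_id q).const_sub p
    refine (h1.comp q h2).congr_fderiv ?_
    ext <;> simp
  have hw := h.2.2 (fun q => η.normed volume (p - q))
    ((η.contDiff_normed (n := ⊤)).comp (contDiff_const.sub contDiff_id))
    (η.hasCompactSupport_normed.comp_homeomorph (Homeomorph.subLeft p))
  have hev : fderiv ℝ (mollify η f) p v =
      ∫ q, f q * fderiv ℝ (η.normed volume) (p - q) v := by
    rw [mollify, hd.fderiv, convolution_eq_swap,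
      ContinuousLinearMap.integral_apply hex.integrable_swap]
    exact integral_congr_ae (.of_forall fun q => by
      simp [ContinuousLinearMap.precompL_apply, mul_comm])
  rw [hev, mollify_apply]
  simp only [(hφ _).fderiv, neg_apply, mul_neg, integral_neg, neg_inj] at hw
  rw [hw]
  exact integral_congr_ae (.of_forall fun q => mul_comm _ _)

theorem tendsto_mollify {η : ℕ → ContDiffBump (0 : Plane)}
    (hη : Tendsto (fun n => (η n).rOut) atTop (𝓝 0)) (hη' : ∀ n, (η n).rOut ≤ 2 * (η n).rIn)
    {f : Plane → ℝ} (hf : Integrable f) :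
    ∀ᵐ p, Tendsto (fun n => mollify (η n) f p) atTop (𝓝 (f p)) :=
  ContDiffBump.ae_convolution_tendsto_right_of_locallyIntegrable hη (.of_forall hη')
    hf.locallyIntegrable

/-! ### Cutoffs -/

/-- `χ` is a `C¹` cutoff function with values in `[0, 1]` whose gradient is bounded by `ε`
(in the dual of the norm of the plane). -/
structure IsCutoff (χ : Plane → ℝ) (ε : ℝ) : Prop where
  contDiff : ContDiff ℝ 1 χ
  hasCompactSupport : HasCompactSupport χ
  nonneg : ∀ p, 0 ≤ χ p
  le_one : ∀ p, χ p ≤ 1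
  abs_fderiv_le : ∀ p v, |fderiv ℝ χ p v| ≤ ε * ‖v‖

theorem exists_isCutoff : ∃ (χ : ℕ → Plane → ℝ) (K : ℝ),
    (∀ n, IsCutoff (χ n) (K * (1 / ((n : ℝ) + 1)))) ∧ ∀ p, ∀ᶠ n in atTop, χ n p = 1 := by
  let χ : ContDiffBump (0 : Plane) := ⟨1, 2, one_pos, one_lt_two⟩
  have hχ : ContDiff ℝ 1 χ := χ.contDiff (n := 1)
  obtain ⟨K, hK⟩ := (χ.hasCompactSupport.fderiv ℝ).exists_bound_of_continuous
    (hχ.continuous_fderiv one_ne_zero)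
  have hpos : ∀ n : ℕ, 0 < 1 / ((n : ℝ) + 1) := fun n => by positivity
  refine ⟨fun n p => χ ((1 / ((n : ℝ) + 1)) • p), K, fun n => ⟨hχ.comp (contDiff_const_smul _),
    χ.hasCompactSupport.comp_smul (hpos n).ne', fun p => χ.nonneg, fun p => χ.le_one,
    fun p v => ?_⟩, fun p => ?_⟩
  · have h1 : HasFDerivAt (fun p => χ ((1 / ((n : ℝ) + 1)) • p)) _ p :=
      (hχ.differentiable one_ne_zero ((1 / ((n : ℝ) + 1)) • p)).hasFDerivAt.comp p
        ((hasFDerivAt_id p).const_smul (1 / ((n : ℝ) + 1)))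
    have h2 : fderiv ℝ (fun p => χ ((1 / ((n : ℝ) + 1)) • p)) p v =
        (1 / ((n : ℝ) + 1)) * fderiv ℝ χ ((1 / ((n : ℝ) + 1)) • p) v := by
      rw [h1.fderiv]; simp
    rw [h2, abs_mul, abs_of_pos (hpos n), mul_comm K, mul_assoc]
    refine mul_le_mul_of_nonneg_left ?_ (hpos n).le
    exact (ContinuousLinearMap.le_opNorm _ v).trans
      (mul_le_mul_of_nonneg_right (hK _) (norm_nonneg v))
  · have : Tendsto (fun n : ℕ => (1 / ((n : ℝ) + 1)) • p) atTop (𝓝 ((0 : ℝ) • p)) :=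
      tendsto_one_div_add_atTop_nhds_zero_nat.smul_const p
    rw [zero_smul] at this
    filter_upwards [this (Metric.closedBall_mem_nhds 0 one_pos)] with n hn
    exact χ.one_of_mem_closedBall hn

/-! ### Fatou's lemma with converging bounds -/

/-- Fatou's lemma with a converging sequence of bounds, for real-valued integrals. -/
theorem integral_le_of_ae_tendsto {F : ℕ → Plane → ℝ} {f : Plane → ℝ} {c : ℕ → ℝ} {C : ℝ}
    (hF : ∀ n, Integrable (F n)) (hF0 : ∀ n p, 0 ≤ F n p) (hf : Integrable f)
    (hlim : ∀ᵐ p, Tendsto (fun n => F n p) atTop (𝓝 (f p))) (hc : ∀ n, ∫ p, F n p ≤ c n)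
    (hC : Tendsto c atTop (𝓝 C)) : ∫ p, f p ≤ C := by
  refine le_of_forall_gt fun D hD => ?_
  obtain ⟨E, hCE, hED⟩ := exists_between hD
  refine lt_of_le_of_lt ?_ hED
  have hE0 : 0 ≤ E :=
    (ge_of_tendsto' hC fun n => (integral_nonneg (hF0 n)).trans (hc n)).trans hCE.le
  have hb : ∀ᶠ n in atTop, eLpNorm (F n) 1 volume ≤ ENNReal.ofReal E := by
    filter_upwards [hC.eventually_le_const hCE] with n hn
    rw [eLpNorm_one_eq_lintegral_enorm, ← ofReal_integral_norm_eq_lintegral_enorm (hF n)]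
    refine ENNReal.ofReal_le_ofReal (le_trans (le_of_eq ?_) ((hc n).trans hn))
    exact integral_congr_ae (.of_forall fun p => Real.norm_of_nonneg (hF0 n p))
  have := Lp.eLpNorm_le_of_ae_tendsto hb (fun n => (hF n).aestronglyMeasurable) hlim
  rw [eLpNorm_one_eq_lintegral_enorm, ← ofReal_integral_norm_eq_lintegral_enorm hf,
    ENNReal.ofReal_le_ofReal_iff hE0] at this
  exact (integral_mono hf hf.norm fun p => le_abs_self _).trans this

/-! ### Regularization, square integrability and passage to the limit -/

theorem IsCutoff.bound_nonneg {χ : Plane → ℝ} {ε : ℝ} (hχ : IsCutoff χ ε) : 0 ≤ ε := by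
  have := (abs_nonneg _).trans (hχ.abs_fderiv_le 0 (1, 0))
  simpa using this

/-- A single sequence of cutoffs and mollifiers that regularizes every integrable function, with
convergence almost everywhere. -/
theorem exists_regularization :
    ∃ (χ : ℕ → Plane → ℝ) (η : ℕ → ContDiffBump (0 : Plane)) (ε : ℕ → ℝ),
    (∀ n, IsCutoff (χ n) (ε n)) ∧ Tendsto ε atTop (𝓝 0) ∧
    ∀ f : Plane → ℝ, Integrable f →
      ∀ᵐ p, Tendsto (fun n => χ n p * mollify (η n) f p) atTop (𝓝 (f p)) := by
  obtain ⟨χ, K, hχ, hχ1⟩ := exists_isCutoff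
  have hpos : ∀ n : ℕ, 0 < 1 / ((n : ℝ) + 1) := fun n => by positivity
  let η : ℕ → ContDiffBump (0 : Plane) := fun n =>
    ⟨1 / ((n : ℝ) + 1), 2 * (1 / ((n : ℝ) + 1)), hpos n, by linarith [hpos n]⟩
  refine ⟨χ, η, fun n => K * (1 / ((n : ℝ) + 1)), hχ, ?_, fun f hf => ?_⟩
  · simpa using (tendsto_one_div_add_atTop_nhds_zero_nat (𝕜 := ℝ)).const_mul K
  · have h0 : Tendsto (fun n => (η n).rOut) atTop (𝓝 0) := by
      simpa [η] using (tendsto_one_div_add_atTop_nhds_zero_nat (𝕜 := ℝ)).const_mul 2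
    filter_upwards [tendsto_mollify h0 (fun n => le_rfl) hf] with p hp
    refine hp.congr' ?_
    filter_upwards [hχ1 p] with n hn
    rw [hn, one_mul]

theorem contDiff_cutoff_mul_mollify {χ : Plane → ℝ} {ε : ℝ} (hχ : IsCutoff χ ε)
    (η : ContDiffBump (0 : Plane)) {f : Plane → ℝ} (hf : Integrable f) :
    ContDiff ℝ 1 fun p => χ p * mollify η f p :=
  hχ.contDiff.mul (contDiff_mollify η hf)

theorem hasCompactSupport_cutoff_mul_mollify {χ : Plane → ℝ} {ε : ℝ} (hχ : IsCutoff χ ε)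
    (η : ContDiffBump (0 : Plane)) (f : Plane → ℝ) :
    HasCompactSupport fun p => χ p * mollify η f p :=
  hχ.hasCompactSupport.mul_right

theorem fderiv_cutoff_mul_mollify {χ : Plane → ℝ} {ε : ℝ} (hχ : IsCutoff χ ε)
    (η : ContDiffBump (0 : Plane)) {f g : Plane → ℝ} {v : Plane} (hf : Integrable f)
    (h : IsWeakDeriv v f g) (p : Plane) :
    fderiv ℝ (fun p => χ p * mollify η f p) p v =
      χ p * mollify η g p + mollify η f p * fderiv ℝ χ p v := by
  rw [fderiv_fun_mul (hχ.contDiff.differentiable one_ne_zero p)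
    ((contDiff_mollify η hf).differentiable one_ne_zero p)]
  simp [fderiv_mollify η hf h]

/-- The `L¹` norm of the divergence of a regularized field exceeds that of the weak divergence at
most by a multiple of the bound `ε` for the gradient of the cutoff. -/
theorem integral_abs_fderiv_add_fderiv_cutoff_mul_mollify_le {χ : Plane → ℝ} {ε : ℝ}
    (hχ : IsCutoff χ ε) (η : ContDiffBump (0 : Plane)) {s t gs gt : Plane → ℝ}
    {v w : Plane} (hv : ‖v‖ ≤ 1) (hw : ‖w‖ ≤ 1)
    (hs : Integrable s) (ht : Integrable t) (hgs : Integrable gs) (hgt : Integrable gt)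
    (hsw : IsWeakDeriv v s gs) (htw : IsWeakDeriv w t gt) :
    ∫ p, |fderiv ℝ (fun p => χ p * mollify η s p) p v +
        fderiv ℝ (fun p => χ p * mollify η t p) p w| ≤
      (∫ p, |gs p + gt p|) + ε * ((∫ p, |s p|) + ∫ p, |t p|) := by
  have hε := hχ.bound_nonneg
  have hd : Integrable fun p => gs p + gt p := hgs.add hgt
  have hs' := (integrable_mollify η hs).abs
  have ht' := (integrable_mollify η ht).abs
  have hd' := (integrable_mollify η hd).abs
  have hst : Integrable fun p => |mollify η s p| + |mollify η t p| := hs'.add ht'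
  calc ∫ p, |fderiv ℝ (fun p => χ p * mollify η s p) p v +
        fderiv ℝ (fun p => χ p * mollify η t p) p w|
      ≤ ∫ p, (|mollify η (fun q => gs q + gt q) p| +
          ε * (|mollify η s p| + |mollify η t p|)) := by
        refine integral_mono ?_ (hd'.add ((hs'.add ht').const_mul ε)) fun p => ?_
        · exact ((integrable_fderiv_apply (contDiff_cutoff_mul_mollify hχ η hs)
            (hasCompactSupport_cutoff_mul_mollify hχ η s) v).add
            (integrable_fderiv_apply (contDiff_cutoff_mul_mollify hχ η ht)
            (hasCompactSupport_cutoff_mul_mollify hχ η t) w)).abs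
        · have h1 : ∀ {u : Plane}, ‖u‖ ≤ 1 → ∀ m : ℝ, |m * fderiv ℝ χ p u| ≤ ε * |m| :=
            fun hu m => by
              rw [abs_mul, mul_comm]
              refine mul_le_mul_of_nonneg_right ((hχ.abs_fderiv_le p _).trans ?_) (abs_nonneg m)
              exact mul_le_of_le_one_right hε hu
          have h2 : |χ p * mollify η (fun q => gs q + gt q) p| ≤
              |mollify η (fun q => gs q + gt q) p| := by
            rw [abs_mul, abs_of_nonneg (hχ.nonneg p)]
            exact mul_le_of_le_one_left (abs_nonneg _) (hχ.le_one p)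
          simp only [fderiv_cutoff_mul_mollify hχ η hs hsw, fderiv_cutoff_mul_mollify hχ η ht htw]
          rw [show ∀ A B C D : ℝ, χ p * A + B + (χ p * C + D) = χ p * (A + C) + (B + D) by
            intros; ring, ← mollify_add η hgs hgt, mul_add]
          exact (abs_add_le _ _).trans (add_le_add h2
            ((abs_add_le _ _).trans (add_le_add (h1 hv _) (h1 hw _))))
    _ = (∫ p, |mollify η (fun q => gs q + gt q) p|) +
          ε * ((∫ p, |mollify η s p|) + ∫ p, |mollify η t p|) := by
        rw [integral_add hd' (hst.const_mul ε), integral_const_mul, integral_add hs' ht']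
    _ ≤ _ := add_le_add (integral_abs_mollify_le η hd) (mul_le_mul_of_nonneg_left
        (add_le_add (integral_abs_mollify_le η hs) (integral_abs_mollify_le η ht)) hε)

theorem integral_sq_cutoff_mul_mollify_le {χ : Plane → ℝ} {ε : ℝ} (hχ : IsCutoff χ ε)
    (η : ContDiffBump (0 : Plane)) {f : Plane → ℝ} (hf : Integrable f)
    (hf2 : Integrable fun p => f p ^ 2) :
    ∫ p, (χ p * mollify η f p) ^ 2 ≤ ∫ p, f p ^ 2 := by
  rw [← integral_mollify η hf2]
  refine integral_mono_of_nonneg (.of_forall fun p => sq_nonneg _) (integrable_mollify η hf2)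
    (.of_forall fun p => le_trans ?_ (sq_mollify_le η hf hf2 p))
  simp only [mul_pow]
  exact mul_le_of_le_one_left (sq_nonneg _) (pow_le_one₀ (hχ.nonneg p) (hχ.le_one p))

/-- The Gagliardo–Nirenberg–Sobolev inequality in the plane, in terms of the partial derivatives. -/
theorem eLpNorm_two_le {u : Plane → ℝ} (hu : ContDiff ℝ 1 u) (hc : HasCompactSupport u) :
    eLpNorm u 2 volume ≤ eLpNormLESNormFDerivOneConst (volume : Measure Plane) 2 *
      ENNReal.ofReal ((∫ p, |fderiv ℝ u p (1, 0)|) + ∫ p, |fderiv ℝ u p (0, 1)|) := by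
  have hp : NNReal.HolderConjugate (Module.finrank ℝ Plane) 2 := by
    simpa using NNReal.HolderConjugate.two_two
  refine (eLpNorm_le_eLpNorm_fderiv_one volume hu hc hp).trans ?_
  have hx := (integrable_fderiv_apply hu hc (1, 0)).abs
  have hy := (integrable_fderiv_apply hu hc (0, 1)).abs
  have hi : Integrable (fderiv ℝ u) :=
    (hu.continuous_fderiv one_ne_zero).integrable_of_hasCompactSupport (hc.fderiv ℝ)
  refine mul_le_mul_right ?_ _
  rw [eLpNorm_one_eq_lintegral_enorm, ← ofReal_integral_norm_eq_lintegral_enorm hi,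
    ← integral_add hx hy]
  refine ENNReal.ofReal_le_ofReal (integral_mono hi.norm (hx.add hy) fun p => ?_)
  refine ContinuousLinearMap.opNorm_le_bound _ (by positivity) fun v => ?_
  have hv : fderiv ℝ u p v = v.1 * fderiv ℝ u p (1, 0) + v.2 * fderiv ℝ u p (0, 1) := by
    conv_lhs => rw [show v = v.1 • ((1, 0) : Plane) + v.2 • ((0, 1) : Plane) by ext <;> simp]
    simp only [map_add, map_smul, smul_eq_mul]
  rw [hv, add_mul]
  refine (norm_add_le _ _).trans (add_le_add ?_ ?_) <;>
    rw [norm_mul, Real.norm_eq_abs (fderiv ℝ u p _), mul_comm] <;>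
    refine mul_le_mul_of_nonneg_left ?_ (abs_nonneg _)
  · exact norm_fst_le v
  · exact norm_snd_le v

theorem isWeakDeriv_zero (v : Plane) : IsWeakDeriv v (fun _ => 0) (fun _ => 0) :=
  ⟨(integrable_zero _ _ _).locallyIntegrable, (integrable_zero _ _ _).locallyIntegrable, by simp⟩

/-- `W^{1,1}(ℝ²) ⊆ L²(ℝ²)`: the regularizations are bounded in `L²` by the Sobolev inequality. -/
theorem MemW11.integrable_sq {f : Plane → ℝ} (hf : MemW11 f) : Integrable fun p => f p ^ 2 := by
  obtain ⟨hf, ⟨gx, hgx, hwx⟩, ⟨gy, hgy, hwy⟩⟩ := hf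
  obtain ⟨χ, η, ε, hχ, hε, hlim⟩ := exists_regularization
  obtain ⟨N, hN⟩ := hε.bddAbove_range
  have hN' : ∀ n, ε n ≤ N := fun n => hN ⟨n, rfl⟩
  have key : ∀ {v : Plane} {g : Plane → ℝ}, ‖v‖ ≤ 1 → Integrable g → IsWeakDeriv v f g → ∀ n,
      ∫ p, |fderiv ℝ (fun p => χ n p * mollify (η n) f p) p v| ≤
        (∫ p, |g p|) + N * ∫ p, |f p| := fun {v g} hv hg hw n => by
    have h := integral_abs_fderiv_add_fderiv_cutoff_mul_mollify_le (hχ n) (η n) hv hv hf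
      (integrable_zero _ _ _) hg (integrable_zero _ _ _) hw (isWeakDeriv_zero v)
    simp only [mollify_apply, mul_zero, integral_zero, fderiv_fun_const, Pi.zero_apply,
      zero_apply, add_zero, abs_zero] at h
    simp only [mollify_apply]
    have h0 : 0 ≤ ∫ p, |f p| := integral_nonneg fun p => abs_nonneg (f p)
    exact h.trans (add_le_add le_rfl (mul_le_mul_of_nonneg_right (hN' n) h0))
  set B : ℝ := ((∫ p, |gx p|) + N * ∫ p, |f p|) + ((∫ p, |gy p|) + N * ∫ p, |f p|)
  have hb : ∀ᶠ n in atTop, eLpNorm (fun p => χ n p * mollify (η n) f p) 2 volume ≤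
      eLpNormLESNormFDerivOneConst (volume : Measure Plane) 2 * ENNReal.ofReal B :=
    .of_forall fun n => (eLpNorm_two_le (contDiff_cutoff_mul_mollify (hχ n) (η n) hf)
      (hasCompactSupport_cutoff_mul_mollify (hχ n) (η n) f)).trans (by
        gcongr
        exact add_le_add (key (by simp) hgx hwx n) (key (by simp) hgy hwy n))
  have h2 := Lp.eLpNorm_le_of_ae_tendsto hb (fun n =>
    (contDiff_cutoff_mul_mollify (hχ n) (η n) hf).continuous.aestronglyMeasurable) (hlim f hf)
  have : MemLp f 2 volume := ⟨hf.aestronglyMeasurable,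
    h2.trans_lt (ENNReal.mul_lt_top ENNReal.coe_lt_top ENNReal.ofReal_lt_top)⟩
  exact this.integrable_sq

theorem MemW11.integrable_mul {f g : Plane → ℝ} (hf : MemW11 f) (hg : MemW11 g) :
    Integrable fun p => f p * g p :=
  ((memLp_two_iff_integrable_sq hf.1.aestronglyMeasurable).2 hf.integrable_sq).integrable_mul
    ((memLp_two_iff_integrable_sq hg.1.aestronglyMeasurable).2 hg.integrable_sq)

/-- The inequality for `W^{1,1}` fields `S = (s, t)` and `T = (a, b)`. Almost everywhere convergence
of the regularizations suffices, as their `L²` norms do not exceed those of the limit. -/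
theorem integral_det_le {s t a b gs gt ga gb : Plane → ℝ} (hs : MemW11 s) (ht : MemW11 t)
    (ha : MemW11 a) (hb : MemW11 b) (hs0 : ∀ᵐ p, 0 ≤ s p) (hb0 : ∀ᵐ p, 0 ≤ b p)
    (hgs : Integrable gs) (hgt : Integrable gt) (hga : Integrable ga) (hgb : Integrable gb)
    (hsw : IsWeakDeriv (1, 0) s gs) (htw : IsWeakDeriv (0, 1) t gt)
    (haw : IsWeakDeriv (1, 0) a ga) (hbw : IsWeakDeriv (0, 1) b gb) :
    ∫ p, (s p * b p - t p * a p) ≤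
      1 / 4 * (∫ p, |gs p + gt p|) * ∫ p, |ga p + gb p| := by
  obtain ⟨χ, η, ε, hχ, hε, hlim⟩ := exists_regularization
  set r : ℕ → (Plane → ℝ) → Plane → ℝ := fun n f p => χ n p * mollify (η n) f p with hr
  have hrc : ∀ n {f : Plane → ℝ}, MemW11 f → ContDiff ℝ 1 (r n f) :=
    fun n f hf => contDiff_cutoff_mul_mollify (hχ n) (η n) hf.1
  have hrs : ∀ n f, HasCompactSupport (r n f) :=
    fun n f => hasCompactSupport_cutoff_mul_mollify (hχ n) (η n) f
  have hr0 : ∀ n {f : Plane → ℝ}, (∀ᵐ p, 0 ≤ f p) → ∀ p, 0 ≤ r n f p :=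
    fun n f hf p => mul_nonneg ((hχ n).nonneg p) (mollify_nonneg (η n) hf p)
  have hmul : ∀ n {f g : Plane → ℝ}, MemW11 f → MemW11 g →
      Integrable fun p => r n f p * r n g p := fun n f g hf hg =>
    ((hrc n hf).continuous.mul (hrc n hg).continuous).integrable_of_hasCompactSupport
      (hrs n f).mul_right
  have hsq : ∀ n {f : Plane → ℝ}, MemW11 f → Integrable fun p => r n f p ^ 2 :=
    fun n f hf => by simpa only [sq] using hmul n hf hf
  have hsqle : ∀ n {f : Plane → ℝ}, MemW11 f → ∫ p, r n f p ^ 2 ≤ ∫ p, f p ^ 2 :=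
    fun n f hf => integral_sq_cutoff_mul_mollify_le (hχ n) (η n) hf.1 hf.integrable_sq
  -- the `L²` norms of the limits, which bound those of the regularizations
  set Q : ℝ := 1 / 2 * ((∫ p, s p ^ 2) + (∫ p, t p ^ 2) + (∫ p, a p ^ 2) + ∫ p, b p ^ 2) with hQ
  -- Fatou's lemma applies to the determinants after adding a nonnegative function whose
  -- integral does not increase under the regularization.
  have expand : ∀ {s t a b : Plane → ℝ}, Integrable (fun p => s p ^ 2) →
      Integrable (fun p => t p ^ 2) → Integrable (fun p => a p ^ 2) →
      Integrable (fun p => b p ^ 2) → Integrable (fun p => s p * b p) →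
      Integrable (fun p => t p * a p) →
      Integrable (fun p => 1 / 2 * (s p ^ 2 + t p ^ 2 + a p ^ 2 + b p ^ 2) +
        (s p * b p - t p * a p)) ∧
      ∫ p, (1 / 2 * (s p ^ 2 + t p ^ 2 + a p ^ 2 + b p ^ 2) + (s p * b p - t p * a p)) =
        1 / 2 * ((∫ p, s p ^ 2) + (∫ p, t p ^ 2) + (∫ p, a p ^ 2) + ∫ p, b p ^ 2) +
          ∫ p, (s p * b p - t p * a p) := fun {s t a b} h1 h2 h3 h4 h5 h6 => by
    have h12 : Integrable fun p => s p ^ 2 + t p ^ 2 := h1.add h2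
    have h123 : Integrable fun p => s p ^ 2 + t p ^ 2 + a p ^ 2 := h12.add h3
    have h1234 : Integrable fun p => s p ^ 2 + t p ^ 2 + a p ^ 2 + b p ^ 2 := h123.add h4
    have h56 : Integrable fun p => s p * b p - t p * a p := h5.sub h6
    refine ⟨(h1234.const_mul _).add h56, ?_⟩
    rw [integral_add (h1234.const_mul _) h56, integral_const_mul, integral_add h123 h4,
      integral_add h12 h3, integral_add h1 h2]
  obtain ⟨hint, heq⟩ := expand hs.integrable_sq ht.integrable_sq ha.integrable_sq
    hb.integrable_sq (hs.integrable_mul hb) (ht.integrable_mul ha)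
  have hn := fun n => expand (hsq n hs) (hsq n ht) (hsq n ha) (hsq n hb) (hmul n hs hb)
    (hmul n ht ha)
  have hC : Tendsto (fun n => Q + 1 / 4 * ((∫ p, |gs p + gt p|) +
      ε n * ((∫ p, |s p|) + ∫ p, |t p|)) * ((∫ p, |ga p + gb p|) +
      ε n * ((∫ p, |a p|) + ∫ p, |b p|))) atTop
      (𝓝 (Q + 1 / 4 * ((∫ p, |gs p + gt p|) + 0 * ((∫ p, |s p|) + ∫ p, |t p|)) *
        ((∫ p, |ga p + gb p|) + 0 * ((∫ p, |a p|) + ∫ p, |b p|)))) :=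
    (((hε.mul_const _).const_add _ |>.const_mul _).mul ((hε.mul_const _).const_add _)).const_add _
  have := integral_le_of_ae_tendsto (fun n => (hn n).1) (fun n p => ?_) hint ?_ (fun n => ?_) hC
  · rw [heq] at this
    simp only [zero_mul, add_zero] at this
    linarith
  · nlinarith [sq_nonneg (r n s p + r n b p), sq_nonneg (r n t p - r n a p)]
  · filter_upwards [hlim s hs.1, hlim t ht.1, hlim a ha.1, hlim b hb.1] with p h1 h2 h3 h4
    exact (((((h1.pow 2).add (h2.pow 2)).add (h3.pow 2)).add (h4.pow 2)).const_mul _).add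
      ((h1.mul h4).sub (h2.mul h3))
  · rw [(hn n).2]
    have h1 := hsqle n hs
    have h2 := hsqle n ht
    have h3 := hsqle n ha
    have h4 := hsqle n hb
    refine add_le_add (by rw [hQ]; gcongr) ?_
    refine (integral_det_le_of_contDiff (hrc n hs) (hrc n ht) (hrc n ha) (hrc n hb) (hrs n s)
      (hrs n t) (hrs n a) (hrs n b) (hr0 n hs0) (hr0 n hb0)).trans ?_
    have h5 := integral_abs_fderiv_add_fderiv_cutoff_mul_mollify_le (hχ n) (η n)
      (by simp) (by simp) hs.1 ht.1 hgs hgt hsw htw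
    have h6 := integral_abs_fderiv_add_fderiv_cutoff_mul_mollify_le (hχ n) (η n)
      (by simp) (by simp) ha.1 hb.1 hga hgb haw hbw
    refine mul_le_mul (mul_le_mul_of_nonneg_left h5 (by norm_num)) h6
      (integral_nonneg fun p => abs_nonneg _) ?_
    have := (integral_nonneg fun p => abs_nonneg _).trans h5
    positivity

/-! ### Weak divergence and the inequality for admissible fields -/

/-- Weak derivatives are unique almost everywhere. -/
theorem IsWeakDeriv.ae_eq {v : Plane} {f g h : Plane → ℝ} (hg : IsWeakDeriv v f g)
    (hh : IsWeakDeriv v f h) : g =ᵐ[volume] h := by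
  refine ae_eq_of_integral_contDiff_smul_eq hg.2.1 hh.2.1 fun φ hφ hc => ?_
  have := (hg.2.2 φ hφ hc).symm.trans (hh.2.2 φ hφ hc)
  simpa only [smul_eq_mul, mul_comm, neg_inj] using this

theorem isWeakDeriv_weakDeriv {v : Plane} {f g : Plane → ℝ} (h : IsWeakDeriv v f g) :
    IsWeakDeriv v f (weakDeriv v f) := by
  have hex : ∃ g, IsWeakDeriv v f g := ⟨g, h⟩
  rw [weakDeriv, dif_pos hex]
  exact hex.choose_spec

theorem weakDeriv_ae_eq {v : Plane} {f g : Plane → ℝ} (h : IsWeakDeriv v f g) :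
    weakDeriv v f =ᵐ[volume] g :=
  (isWeakDeriv_weakDeriv h).ae_eq h

theorem fieldDet_eq (S T : Plane → Plane) (p : Plane) :
    fieldDet S T p = (S p).1 * (T p).2 - (S p).2 * (T p).1 := by
  simp [fieldDet, Matrix.det_fin_two]

theorem isWeakDeriv_of_contDiff {f : Plane → ℝ} (hf : ContDiff ℝ 1 f) (hc : HasCompactSupport f)
    (v : Plane) : IsWeakDeriv v f fun p => fderiv ℝ f p v := by
  refine ⟨hf.continuous.locallyIntegrable, (continuous_fderiv_apply hf v).locallyIntegrable,
    fun φ hφ hφc => ?_⟩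
  have hφ1 : ContDiff ℝ 1 φ := hφ.of_le (by norm_cast)
  exact integral_mul_fderiv_eq_neg_fderiv_mul_of_integrable
    (((continuous_fderiv_apply hf v).mul hφ.continuous).integrable_of_hasCompactSupport
      hφc.mul_left)
    ((hf.continuous.mul (continuous_fderiv_apply hφ1 v)).integrable_of_hasCompactSupport
      hc.mul_right)
    ((hf.continuous.mul hφ.continuous).integrable_of_hasCompactSupport hc.mul_right)
    (fun p _ => hf.differentiable one_ne_zero p) (fun p _ => hφ1.differentiable one_ne_zero p)

theorem memW11_of_contDiff {f : Plane → ℝ} (hf : ContDiff ℝ 1 f) (hc : HasCompactSupport f) :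
    MemW11 f :=
  ⟨hf.continuous.integrable_of_hasCompactSupport hc,
    ⟨_, integrable_fderiv_apply hf hc _, isWeakDeriv_of_contDiff hf hc _⟩,
    ⟨_, integrable_fderiv_apply hf hc _, isWeakDeriv_of_contDiff hf hc _⟩⟩

theorem Admissible.integrable_and_integral_le {S T : Plane → Plane} (h : Admissible S T) :
    Integrable (fieldDet S T) volume ∧ ∫ p, fieldDet S T p ≤
      1 / 4 * (∫ p, |weakDiv S p|) * (∫ p, |weakDiv T p|) := by
  obtain ⟨⟨hs, ht⟩, ⟨ha, hb⟩, hs0, hb0, -⟩ := h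
  have hdet : fieldDet S T = fun p => (S p).1 * (T p).2 - (S p).2 * (T p).1 :=
    funext (fieldDet_eq S T)
  rw [hdet]
  refine ⟨(hs.integrable_mul hb).sub (ht.integrable_mul ha), ?_⟩
  have key : ∀ {v : Plane} {f : Plane → ℝ}, (∃ g, Integrable g ∧ IsWeakDeriv v f g) →
      Integrable (weakDeriv v f) ∧ IsWeakDeriv v f (weakDeriv v f) := fun ⟨g, hg, hw⟩ =>
    ⟨hg.congr (weakDeriv_ae_eq hw).symm, isWeakDeriv_weakDeriv hw⟩
  exact integral_det_le hs ht ha hb hs0 hb0 (key hs.2.1).1 (key ht.2.2).1 (key ha.2.1).1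
    (key hb.2.2).1 (key hs.2.1).2 (key ht.2.2).2 (key ha.2.1).2 (key hb.2.2).2

/-! ### Fields for which equality holds -/

/-- A smooth even function which is `1` on `[-1, 1]`, vanishes outside `(-2, 2)` and is monotone on
either side of the origin. -/
noncomputable def plateau (x : ℝ) : ℝ :=
  Real.smoothTransition (2 - x) * Real.smoothTransition (2 + x)

theorem contDiff_plateau : ContDiff ℝ 1 plateau :=
  (Real.smoothTransition.contDiff (n := 1) |>.comp (contDiff_const.sub contDiff_id)).mul
    (Real.smoothTransition.contDiff (n := 1) |>.comp (contDiff_const.add contDiff_id))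

theorem plateau_nonneg (x : ℝ) : 0 ≤ plateau x :=
  mul_nonneg (Real.smoothTransition.nonneg _) (Real.smoothTransition.nonneg _)

theorem plateau_eq_one {x : ℝ} (hx : |x| ≤ 1) : plateau x = 1 := by
  rw [abs_le] at hx
  rw [plateau, Real.smoothTransition.one_of_one_le (by linarith),
    Real.smoothTransition.one_of_one_le (by linarith), one_mul]

theorem plateau_eq_zero {x : ℝ} (hx : 2 ≤ |x|) : plateau x = 0 := by
  rcases le_abs.1 hx with h | h
  · rw [plateau, Real.smoothTransition.zero_of_nonpos (by linarith), zero_mul]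
  · rw [plateau, Real.smoothTransition.zero_of_nonpos (x := 2 + x) (by linarith), mul_zero]

theorem hasCompactSupport_plateau : HasCompactSupport plateau :=
  HasCompactSupport.intro (K := Icc (-2) 2) isCompact_Icc fun x hx => plateau_eq_zero (by
    by_contra! h
    exact hx ⟨(abs_lt.1 h).1.le, (abs_lt.1 h).2.le⟩)

theorem monotoneOn_plateau : MonotoneOn plateau (Iic 1) := fun x hx y hy hxy => by
  simp only [mem_Iic] at hx hy
  rw [plateau, plateau, Real.smoothTransition.one_of_one_le (x := 2 - x) (by linarith),
    Real.smoothTransition.one_of_one_le (x := 2 - y) (by linarith), one_mul, one_mul]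
  exact Real.smoothTransition.monotone (by linarith)

theorem antitoneOn_plateau : AntitoneOn plateau (Ici (-1)) := fun x hx y hy hxy => by
  simp only [mem_Ici] at hx hy
  rw [plateau, plateau, Real.smoothTransition.one_of_one_le (x := 2 + x) (by linarith),
    Real.smoothTransition.one_of_one_le (x := 2 + y) (by linarith), mul_one, mul_one]
  exact Real.smoothTransition.monotone (by linarith)

theorem continuous_deriv_plateau : Continuous (deriv plateau) :=
  contDiff_plateau.continuous_deriv_one

/-- The total variation is `2`, since the function climbs once from `0` to `1` and then descends. -/
theorem integral_abs_deriv_plateau : ∫ x, |deriv plateau x| = 2 := by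
  have hc := continuous_deriv_plateau
  have hd : ∀ x, HasDerivAt plateau (deriv plateau x) x := fun x =>
    (contDiff_plateau.differentiable one_ne_zero x).hasDerivAt
  -- beyond `±2`, where `plateau` vanishes near every point
  have hsupp : Function.support (fun x => |deriv plateau x|) ⊆ Ioc (-3) 3 := fun x hx => by
    by_contra hn
    refine hx ?_
    have h2 : 2 < |x| := by
      by_contra! h
      exact hn ⟨by linarith [(abs_le.1 h).1], by linarith [(abs_le.1 h).2]⟩
    have : plateau =ᶠ[𝓝 x] fun _ => 0 := by
      filter_upwards [continuous_abs.continuousAt.eventually (lt_mem_nhds h2)] with y hy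
      exact plateau_eq_zero hy.le
    simp [this.deriv_eq]
  have hl : ∫ x in (-3)..0, |deriv plateau x| = 1 := by
    have : ∫ x in (-3)..0, |deriv plateau x| = ∫ x in (-3)..0, deriv plateau x := by
      refine intervalIntegral.integral_congr fun x hx => abs_of_nonneg ?_
      rw [uIcc_of_le (by norm_num)] at hx
      have : 0 ≤ derivWithin plateau (Iic 1) x := monotoneOn_plateau.derivWithin_nonneg
      rwa [derivWithin_of_mem_nhds (Iic_mem_nhds (by linarith [hx.2]))] at this
    rw [this, intervalIntegral.integral_eq_sub_of_hasDerivAt (fun x _ => hd x)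
      (hc.intervalIntegrable _ _), plateau_eq_one (by simp), plateau_eq_zero (by norm_num),
      sub_zero]
  have hr : ∫ x in (0)..3, |deriv plateau x| = 1 := by
    have : ∫ x in (0)..3, |deriv plateau x| = ∫ x in (0)..3, -deriv plateau x := by
      refine intervalIntegral.integral_congr fun x hx => abs_of_nonpos ?_
      rw [uIcc_of_le (by norm_num)] at hx
      have : derivWithin plateau (Ici (-1)) x ≤ 0 := antitoneOn_plateau.derivWithin_nonpos
      rwa [derivWithin_of_mem_nhds (Ici_mem_nhds (by linarith [hx.1]))] at this
    rw [this, intervalIntegral.integral_neg, intervalIntegral.integral_eq_sub_of_hasDerivAt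
      (fun x _ => hd x) (hc.intervalIntegrable _ _), plateau_eq_zero (x := 3) (by norm_num),
      plateau_eq_one (by simp)]
    norm_num
  rw [← intervalIntegral.integral_eq_integral_of_support_subset hsupp,
    ← intervalIntegral.integral_add_adjacent_intervals (b := 0)
      (hc.abs.intervalIntegrable _ _) (hc.abs.intervalIntegrable _ _), hl, hr]
  norm_num

/-- A nonnegative smooth function supported where `plateau` equals `1`. -/
noncomputable def narrow (x : ℝ) : ℝ := plateau (2 * x)

theorem contDiff_narrow : ContDiff ℝ 1 narrow :=
  contDiff_plateau.comp (contDiff_const.mul contDiff_id)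

theorem narrow_nonneg (x : ℝ) : 0 ≤ narrow x := plateau_nonneg _

theorem narrow_eq_zero {x : ℝ} (hx : 1 ≤ |x|) : narrow x = 0 :=
  plateau_eq_zero (by rw [abs_mul, abs_two]; linarith)

theorem plateau_mul_narrow (x : ℝ) : plateau x * narrow x = narrow x := by
  rcases le_total |x| 1 with h | h
  · rw [plateau_eq_one h, one_mul]
  · rw [narrow_eq_zero h, mul_zero]

theorem hasCompactSupport_narrow : HasCompactSupport narrow :=
  HasCompactSupport.intro (K := Icc (-1) 1) isCompact_Icc fun x hx => narrow_eq_zero (by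
    by_contra! h
    exact hx ⟨(abs_lt.1 h).1.le, (abs_lt.1 h).2.le⟩)

theorem integral_narrow_pos : 0 < ∫ x, narrow x := by
  refine contDiff_narrow.continuous.integral_pos_of_hasCompactSupport_nonneg_nonzero
    hasCompactSupport_narrow narrow_nonneg (x := 0) ?_
  rw [narrow, plateau_eq_one (by simp)]
  exact one_ne_zero

theorem hasCompactSupport_fst_mul_snd {f g : ℝ → ℝ} (hf : HasCompactSupport f)
    (hg : HasCompactSupport g) : HasCompactSupport fun p : Plane => f p.1 * g p.2 := by
  refine HasCompactSupport.intro (hf.isCompact.prod hg.isCompact) fun p hp => ?_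
  rw [mem_prod, not_and_or] at hp
  rcases hp with h | h
  · rw [image_eq_zero_of_notMem_tsupport h, zero_mul]
  · rw [image_eq_zero_of_notMem_tsupport h, mul_zero]

theorem contDiff_fst_mul_snd {f g : ℝ → ℝ} (hf : ContDiff ℝ 1 f) (hg : ContDiff ℝ 1 g) :
    ContDiff ℝ 1 fun p : Plane => f p.1 * g p.2 :=
  (hf.comp contDiff_fst).mul (hg.comp contDiff_snd)

/-- A flow to the right through the horizontal strip where `narrow` does not vanish. -/
noncomputable def horizontalField (p : Plane) : Plane := (plateau p.1 * narrow p.2, 0)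

/-- A flow upwards through the vertical strip where `narrow` does not vanish; every line of this
flow meets every line of `horizontalField`, at a place where both `plateau` factors are `1`. -/
noncomputable def verticalField (p : Plane) : Plane := (0, narrow p.1 * plateau p.2)

theorem memW11_zero : MemW11 fun _ => 0 :=
  ⟨integrable_zero _ _ _, ⟨_, integrable_zero _ _ _, isWeakDeriv_zero _⟩,
    ⟨_, integrable_zero _ _ _, isWeakDeriv_zero _⟩⟩

theorem fieldDet_horizontalField_verticalField (p : Plane) :
    fieldDet horizontalField verticalField p = narrow p.1 * narrow p.2 := by
  rw [fieldDet_eq]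
  simp only [horizontalField, verticalField]
  calc plateau p.1 * narrow p.2 * (narrow p.1 * plateau p.2) - 0 * 0 =
        (plateau p.1 * narrow p.1) * (plateau p.2 * narrow p.2) := by ring
    _ = narrow p.1 * narrow p.2 := by rw [plateau_mul_narrow, plateau_mul_narrow]

theorem admissible_horizontalField_verticalField : Admissible horizontalField verticalField where
  left_mem := ⟨memW11_of_contDiff (contDiff_fst_mul_snd contDiff_plateau contDiff_narrow)
    (hasCompactSupport_fst_mul_snd hasCompactSupport_plateau hasCompactSupport_narrow),
    memW11_zero⟩
  right_mem := ⟨memW11_zero, memW11_of_contDiff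
    (contDiff_fst_mul_snd contDiff_narrow contDiff_plateau)
    (hasCompactSupport_fst_mul_snd hasCompactSupport_narrow hasCompactSupport_plateau)⟩
  left_nonneg := .of_forall fun p => mul_nonneg (plateau_nonneg _) (narrow_nonneg _)
  right_nonneg := .of_forall fun p => mul_nonneg (narrow_nonneg _) (plateau_nonneg _)
  det_nonneg := .of_forall fun p => by
    rw [fieldDet_horizontalField_verticalField]
    exact mul_nonneg (narrow_nonneg _) (narrow_nonneg _)

theorem integral_abs_weakDiv_horizontalField :
    ∫ p, |weakDiv horizontalField p| = 2 * ∫ x, narrow x := by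
  have hc := contDiff_fst_mul_snd contDiff_plateau contDiff_narrow
  have h1 := weakDeriv_ae_eq (isWeakDeriv_of_contDiff hc
    (hasCompactSupport_fst_mul_snd hasCompactSupport_plateau hasCompactSupport_narrow) (1, 0))
  have h2 := weakDeriv_ae_eq (isWeakDeriv_zero (0, 1))
  have h3 : ∀ p : Plane, fderiv ℝ (fun p : Plane => plateau p.1 * narrow p.2) p (1, 0) =
      deriv plateau p.1 * narrow p.2 := fun p =>
    (hasDerivAt_slice_fst hc p.1 p.2).unique
      ((contDiff_plateau.differentiable one_ne_zero p.1).hasDerivAt.mul_const (narrow p.2))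
  rw [← integral_abs_deriv_plateau, ← integral_prod_mul (fun x => |deriv plateau x|) narrow]
  refine integral_congr_ae ?_
  filter_upwards [h1, h2] with p hp1 hp2
  simp only [weakDiv, horizontalField]
  rw [hp1, hp2, h3, add_zero, abs_mul, abs_of_nonneg (narrow_nonneg _)]

theorem integral_abs_weakDiv_verticalField :
    ∫ p, |weakDiv verticalField p| = 2 * ∫ x, narrow x := by
  have hc := contDiff_fst_mul_snd contDiff_narrow contDiff_plateau
  have h1 := weakDeriv_ae_eq (isWeakDeriv_of_contDiff hc
    (hasCompactSupport_fst_mul_snd hasCompactSupport_narrow hasCompactSupport_plateau) (0, 1))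
  have h2 := weakDeriv_ae_eq (isWeakDeriv_zero (1, 0))
  have h3 : ∀ p : Plane, fderiv ℝ (fun p : Plane => narrow p.1 * plateau p.2) p (0, 1) =
      narrow p.1 * deriv plateau p.2 := fun p =>
    (hasDerivAt_slice_snd hc p.1 p.2).unique
      ((contDiff_plateau.differentiable one_ne_zero p.2).hasDerivAt.const_mul (narrow p.1))
  rw [← integral_abs_deriv_plateau, mul_comm,
    ← integral_prod_mul narrow (fun x => |deriv plateau x|)]
  refine integral_congr_ae ?_
  filter_upwards [h1, h2] with p hp1 hp2
  simp only [weakDiv, verticalField]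
  rw [hp1, hp2, h3, zero_add, abs_mul, abs_of_nonneg (narrow_nonneg _)]

theorem integral_fieldDet_horizontalField_verticalField :
    ∫ p, fieldDet horizontalField verticalField p = (∫ x, narrow x) * ∫ x, narrow x := by
  simp only [fieldDet_horizontalField_verticalField]
  exact integral_prod_mul narrow narrow

end PlaneSobolev

theorem theorem3p4 :
    (∀ S T : PlaneSobolev.Plane → PlaneSobolev.Plane, PlaneSobolev.Admissible S T →
      Integrable (PlaneSobolev.fieldDet S T) volume ∧
        ∫ p, PlaneSobolev.fieldDet S T p ≤
          1 / 4 * (∫ p, |PlaneSobolev.weakDiv S p|) * (∫ p, |PlaneSobolev.weakDiv T p|)) ∧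
    (∀ C : ℝ, C < 1 / 4 →
      ∃ S T : PlaneSobolev.Plane → PlaneSobolev.Plane, PlaneSobolev.Admissible S T ∧
        C * (∫ p, |PlaneSobolev.weakDiv S p|) * (∫ p, |PlaneSobolev.weakDiv T p|) <
          ∫ p, PlaneSobolev.fieldDet S T p) := by
  refine ⟨fun S T h => h.integrable_and_integral_le, fun C hC => ⟨PlaneSobolev.horizontalField,
    PlaneSobolev.verticalField, PlaneSobolev.admissible_horizontalField_verticalField, ?_⟩⟩
  rw [PlaneSobolev.integral_abs_weakDiv_horizontalField,
    PlaneSobolev.integral_abs_weakDiv_verticalField,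
    PlaneSobolev.integral_fieldDet_horizontalField_verticalField]
  have h := mul_pos PlaneSobolev.integral_narrow_pos PlaneSobolev.integral_narrow_pos
  calc _ = 4 * C * ((∫ x, PlaneSobolev.narrow x) * ∫ x, PlaneSobolev.narrow x) := by ring
    _ < 1 * _ := mul_lt_mul_of_pos_right (by linarith) h
    _ = _ := one_mul _
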